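/- Let $M$ be a $C^\infty$ manifold (finite-dimensional, Hausdorff, without boundary); all tensor fields are of class $C^\infty$. A bivector field $\Lambda$ on $M$ is identified with the skew-symmetric $C^\infty(M)$-linear map $\Lambda:\Omega^1(M)\to\mathfrak X(M)$ given by $\langle\beta,\Lambda\alpha\rangle=\Lambda(\alpha,\beta)$, and $[\cdot,\cdot]$ denotes the Schouten–Nijenhuis bracket. A Poisson tensor is a bivector field $\pi$ with $[\pi,\pi]=0$. A homogeneous Poisson manifold $(M,\pi,Z)$ is a manifold $M$ with a Poisson tensor $\pi$ and a vector field $Z$ such that $[Z,\pi]=-\pi$. For a bivector field $\Lambda$ put $\{\alpha,\beta\}_\Lambda=L_{\Lambda\alpha}\beta-L_{\Lambda\beta}\alpha-d(\Lambda(\alpha,\beta))$ for $\alpha,\beta\in\Omega^1(M)$, where $L_X=i_Xd+d\,i_X$ is the Lie derivative. A $(1,1)$-tensor field $J$ is a Nijenhuis tensor if $[JX,JY]-J[JX,Y]-J[X,JY]+J^2[X,Y]=0$ for all vector fields $X,Y$. A Nijenhuis tensor $J$ is compatible with a Poisson tensor $\pi$ if $J\circ\pi=\pi\circ{}^tJ$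 and, for all $\alpha,\beta\in\Omega^1(M)$, $$\{\alpha,\beta\}_{J\pi}-\big(\{{}^tJ\alpha,\beta\}_\pi+\{\alpha,{}^tJ\beta\}_\pi-{}^tJ\{\alpha,\beta\}_\pi\big)=0,$$ where $J\pi$ is the bivector field $J\circ\pi$. Theorem. Let $(M,\pi,Z)$ be a homogeneous Poisson manifold and let $J$ be a Nijenhuis tensor compatible with $\pi$. Then $(M,J\pi,Z)$ is a homogeneous Poisson manifold if and only if $$\pi\circ(L_Z\circ{}^tJ-{}^tJ\circ L_Z)=0\quad\text{on }\Omega^1(M).$$ When this holds, $J\pi-\lambda\pi$ is a Poisson pencil homogeneous with respect to $Z$: the tensors $J\pi$, $\pi$ and $J\pi-\lambda\pi$ for every $\lambda\in\mathbb R$ are Poisson tensors, and $[Z,J\pi-\lambda\pi]=-(J\pi-\lambda\pi)$ for every $\lambda\in\mathbb R$. -/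

import Mathlib

open scoped Manifold ContDiff

noncomputable section

namespace PoissonNijenhuis

open Bundle

/-! Tensor fields on a manifold `M` modelled on `E`, as families indexed by the points of `M`. Their
smoothness is expressed through Mathlib's tangent bundle and hom bundles. -/

section Fields

variable (E : Type*) [NormedAddCommGroup E] [NormedSpace ℝ E]
  (M : Type*) [TopologicalSpace M] [ChartedSpace E M]

/-- Vector fields on `M`. -/
abbrev VectorField := ∀ x : M, TangentSpace 𝓘(ℝ, E) x

/-- Differential 1-forms on `M`. -/
abbrev OneForm := ∀ x : M, TangentSpace 𝓘(ℝ, E) x →L[ℝ] ℝ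

/-- Fields of endomorphisms of the tangent spaces, i.e. (1,1)-tensor fields. -/
abbrev EndField := ∀ x : M, TangentSpace 𝓘(ℝ, E) x →L[ℝ] TangentSpace 𝓘(ℝ, E) x

/-- Fields of linear maps `T*_x M → T_x M`. A bivector field `Λ` is regarded as such a field, with
`⟨β, Λ α⟩ = Λ(α, β)`. -/
abbrev SharpField :=
  ∀ x : M, (TangentSpace 𝓘(ℝ, E) x →L[ℝ] ℝ) →L[ℝ] TangentSpace 𝓘(ℝ, E) x

end Fields

variable {E : Type*} [NormedAddCommGroup E] [NormedSpace ℝ E]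
  {M : Type*} [TopologicalSpace M] [ChartedSpace E M]

section Smooth

variable [IsManifold 𝓘(ℝ, E) ∞ M]

/-- The vector field `X` is of class `C^∞`. -/
def SmoothVectorField (X : VectorField E M) : Prop :=
  ContMDiff 𝓘(ℝ, E) (𝓘(ℝ, E).prod 𝓘(ℝ, E)) ∞
    (fun x : M => TotalSpace.mk' E (E := fun x : M => TangentSpace 𝓘(ℝ, E) x) x (X x))

/-- The 1-form `α` is of class `C^∞`. -/
def SmoothOneForm (α : OneForm E M) : Prop :=
  ContMDiff 𝓘(ℝ, E) (𝓘(ℝ, E).prod 𝓘(ℝ, E →L[ℝ] ℝ)) ∞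
    (fun x : M => TotalSpace.mk' (E →L[ℝ] ℝ)
      (E := fun x : M => TangentSpace 𝓘(ℝ, E) x →L[ℝ] ℝ) x (α x))

/-- The (1,1)-tensor field `J` is of class `C^∞`. -/
def SmoothEndField (J : EndField E M) : Prop :=
  ContMDiff 𝓘(ℝ, E) (𝓘(ℝ, E).prod 𝓘(ℝ, E →L[ℝ] E)) ∞
    (fun x : M => TotalSpace.mk' (E →L[ℝ] E)
      (E := fun x : M => TangentSpace 𝓘(ℝ, E) x →L[ℝ] TangentSpace 𝓘(ℝ, E) x) x (J x))

/-- The field `Λ` of maps `T*_x M → T_x M` is of class `C^∞`. -/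
def SmoothSharpField (Λ : SharpField E M) : Prop :=
  ContMDiff 𝓘(ℝ, E) (𝓘(ℝ, E).prod 𝓘(ℝ, (E →L[ℝ] ℝ) →L[ℝ] E)) ∞
    (fun x : M => TotalSpace.mk' ((E →L[ℝ] ℝ) →L[ℝ] E)
      (E := fun x : M =>
        (TangentSpace 𝓘(ℝ, E) x →L[ℝ] ℝ) →L[ℝ] TangentSpace 𝓘(ℝ, E) x) x (Λ x))

/-- `Λ` is a (smooth) bivector field: `⟨α, Λ β⟩ + ⟨β, Λ α⟩ = 0`. -/
def IsBivectorField (Λ : SharpField E M) : Prop :=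
  SmoothSharpField Λ ∧
    ∀ (x : M) (a b : TangentSpace 𝓘(ℝ, E) x →L[ℝ] ℝ), a (Λ x b) + b (Λ x a) = 0

end Smooth

section Operations

/-- The vector field `Λ α`. -/
def sharp (Λ : SharpField E M) (α : OneForm E M) : VectorField E M := fun x => Λ x (α x)

/-- The function `Λ(α, β) = ⟨β, Λ α⟩`. -/
def pairing (Λ : SharpField E M) (α β : OneForm E M) : M → ℝ := fun x => β x (Λ x (α x))

/-- The vector field `J X`. -/
def applyField (J : EndField E M) (X : VectorField E M) : VectorField E M := fun x => J x (X x)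

/-- The 1-form `ᵗJ α`. -/
def transposeForm (J : EndField E M) (α : OneForm E M) : OneForm E M :=
  fun x => (α x).comp (J x)

/-- The field `J ∘ Λ`. -/
def compField (J : EndField E M) (Λ : SharpField E M) : SharpField E M :=
  fun x => (J x).comp (Λ x)

/-- The differential `df` of a function. -/
def differential (f : M → ℝ) : OneForm E M := fun x => mfderiv 𝓘(ℝ, E) 𝓘(ℝ, ℝ) f x

/-- The function `X f = ⟨df, X⟩`. -/
def derivAlong (X : VectorField E M) (f : M → ℝ) : M → ℝ :=
  fun x => differential (E := E) f x (X x)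

/-- The expression of the 1-form `α` in the preferred chart at `x`. -/
def chartForm (α : OneForm E M) (x : M) : E → E →L[ℝ] ℝ := fun y =>
  (α ((extChartAt 𝓘(ℝ, E) x).symm y)).comp
    (mfderiv 𝓘(ℝ, E) 𝓘(ℝ, E) (extChartAt 𝓘(ℝ, E) x).symm y)

/-- The exterior derivative of a 1-form, `dα(u, v) = (D_u α)(v) - (D_v α)(u)` in the preferred chart
at `x`. For fixed `u` this is the covector `dα(u, ·)`. -/
def extDerivOneForm (α : OneForm E M) (x : M) (u : TangentSpace 𝓘(ℝ, E) x) :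
    TangentSpace 𝓘(ℝ, E) x →L[ℝ] ℝ :=
  let A : E →L[ℝ] E →L[ℝ] ℝ := fderiv ℝ (chartForm α x) (extChartAt 𝓘(ℝ, E) x x)
  let D : TangentSpace 𝓘(ℝ, E) x →L[ℝ] E :=
    mfderiv 𝓘(ℝ, E) 𝓘(ℝ, E) (extChartAt 𝓘(ℝ, E) x) x
  (A (D u) - A.flip (D u)).comp D

/-- The Lie derivative of a 1-form, `L_X α = i_X dα + d(i_X α)`. -/
def lieDerivOneForm (X : VectorField E M) (α : OneForm E M) : OneForm E M := fun x =>
  extDerivOneForm α x (X x) + differential (E := E) (fun y => α y (X y)) x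

/-- The bracket of 1-forms `{α, β}_Λ = L_{Λα} β - L_{Λβ} α - d(Λ(α, β))`. -/
def formBracket (Λ : SharpField E M) (α β : OneForm E M) : OneForm E M :=
  lieDerivOneForm (sharp Λ α) β - lieDerivOneForm (sharp Λ β) α - differential (pairing Λ α β)

/-- `C(Λ, J)(α, β) = {α, β}_{JΛ} - ({ᵗJα, β}_Λ + {α, ᵗJβ}_Λ - ᵗJ{α, β}_Λ)`. -/
def concomitant (Λ : SharpField E M) (J : EndField E M) (α β : OneForm E M) : OneForm E M :=
  formBracket (compField J Λ) α β -
    (formBracket Λ (transposeForm J α) β + formBracket Λ α (transposeForm J β) -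
      transposeForm J (formBracket Λ α β))

/-- The Nijenhuis torsion `N_J(X, Y) = [JX, JY] - J[JX, Y] - J[X, JY] + J²[X, Y]`. -/
def nijenhuisTorsion (J : EndField E M) (X Y : VectorField E M) : VectorField E M :=
  VectorField.mlieBracket 𝓘(ℝ, E) (applyField J X) (applyField J Y) -
    applyField J (VectorField.mlieBracket 𝓘(ℝ, E) (applyField J X) Y) -
    applyField J (VectorField.mlieBracket 𝓘(ℝ, E) X (applyField J Y)) +
    applyField J (applyField J (VectorField.mlieBracket 𝓘(ℝ, E) X Y))

/-- The Schouten-Nijenhuis bracket `[Z, Λ]` of a vector field and a bivector field, as a skew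
biderivation of the algebra of smooth functions, i.e. through its values `[Z, Λ](df, dg)`. -/
def schoutenVectorBivector (Z : VectorField E M) (Λ : SharpField E M) (f g : M → ℝ) : M → ℝ :=
  derivAlong Z (pairing Λ (differential f) (differential g)) -
    pairing Λ (differential (derivAlong Z f)) (differential g) -
    pairing Λ (differential f) (differential (derivAlong Z g))

/-- `Λ(d(Λ'(df, dg)), dh)`. -/
def nested (Λ Λ' : SharpField E M) (f g h : M → ℝ) : M → ℝ :=
  pairing Λ (differential (pairing Λ' (differential f) (differential g))) (differential h)

/-- The Schouten-Nijenhuis bracket `[Λ, Λ']` of two bivector fields, as a skew triderivation of the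
algebra of smooth functions, i.e. through its values `[Λ, Λ'](df, dg, dh)`. -/
def schoutenBivectorBivector (Λ Λ' : SharpField E M) (f g h : M → ℝ) : M → ℝ :=
  (nested Λ Λ' f g h + nested Λ Λ' g h f + nested Λ Λ' h f g) +
    (nested Λ' Λ f g h + nested Λ' Λ g h f + nested Λ' Λ h f g)

end Operations

section Structures

variable [IsManifold 𝓘(ℝ, E) ∞ M]

/-- `J` is a Nijenhuis tensor. -/
def IsNijenhuisTensor (J : EndField E M) : Prop :=
  SmoothEndField J ∧
    ∀ X Y : VectorField E M, SmoothVectorField X → SmoothVectorField Y →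
      nijenhuisTorsion J X Y = 0

/-- `P` is a Poisson tensor: a bivector field with `[P, P] = 0`. -/
def IsPoisson (P : SharpField E M) : Prop :=
  IsBivectorField P ∧
    ∀ f g h : M → ℝ, ContMDiff 𝓘(ℝ, E) 𝓘(ℝ, ℝ) ∞ f → ContMDiff 𝓘(ℝ, E) 𝓘(ℝ, ℝ) ∞ g →
      ContMDiff 𝓘(ℝ, E) 𝓘(ℝ, ℝ) ∞ h → schoutenBivectorBivector P P f g h = 0

/-- The bivector field `P` satisfies `[Z, P] = -P`. -/
def IsHomogeneous (P : SharpField E M) (Z : VectorField E M) : Prop :=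
  ∀ f g : M → ℝ, ContMDiff 𝓘(ℝ, E) 𝓘(ℝ, ℝ) ∞ f → ContMDiff 𝓘(ℝ, E) 𝓘(ℝ, ℝ) ∞ g →
    schoutenVectorBivector Z P f g = -pairing P (differential f) (differential g)

/-- `(M, P, Z)` is a homogeneous Poisson manifold. -/
def IsHomogeneousPoisson (P : SharpField E M) (Z : VectorField E M) : Prop :=
  IsPoisson P ∧ SmoothVectorField Z ∧ IsHomogeneous P Z

/-- `P` and `J` are compatible: `J ∘ P = P ∘ ᵗJ` and `C(P, J) = 0`. -/
def IsCompatible (P : SharpField E M) (J : EndField E M) : Prop :=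
  (∀ α : OneForm E M, SmoothOneForm α →
      sharp (compField J P) α = sharp P (transposeForm J α)) ∧
    ∀ α β : OneForm E M, SmoothOneForm α → SmoothOneForm β → concomitant P J α β = 0

/-- `P₁ - l P₂`, `l ∈ ℝ`, is a Poisson pencil. -/
def IsPoissonPencil (P₁ P₂ : SharpField E M) : Prop :=
  IsPoisson P₁ ∧ IsPoisson P₂ ∧ ∀ l : ℝ, IsPoisson (P₁ - l • P₂)

end Structures

end PoissonNijenhuis

end

/-! Everything is tested on differentials of smooth functions: bump functions make every covector a
differential (`exists_differential_eq`), so a vector is determined by its pairings with them.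

Homogeneity. `[Z, Λ] = -Λ` amounts to `[Z, Λ df] = Λ d(Zf) - Λ df` for all `f`
(`isHomogeneous_iff`). Applying `J` to this identity for `P` shows that `J P` is homogeneous exactly
when `[Z, J P df] = J [Z, P df]`. On the other hand `(L_Z ᵗJ - ᵗJ L_Z) α` takes the value `α([Z, JX]
- J[Z, X])` on `X`; for `X = P df` the skew-symmetry of `P` turns this into the stated condition
(`sharp_lieDeriv_transpose_iff`).

Poisson property. That `J P` is Poisson needs only that `P` is Poisson, the compatibility and the
vanishing torsion (`isPoisson_compField`). The torsion on `P dg, P dh`, the concomitant on `df, dg`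
and the concomitant on `ᵗJ df, dg` become identities between iterated brackets of functions for `P`,
`J P`, `J² P`, and one further kind of term, `df(J [P dg, J P dh])`. In the cyclic sums the latter
can be eliminated, and the Jacobi identity of `J P` remains.

Pencil. The concomitant on exact forms, evaluated on `P dh`, gives `[P, J P] = 0`
(`bracket_compField_cyclic`), so the bracket of `J P - l P` with itself vanishes. -/

open scoped Manifold ContDiff

set_option linter.unusedSectionVars false

noncomputable section

namespace PoissonNijenhuis

open Bundle

/-! ### Composition of sections of hom bundles -/

section BundleComposition

variable {B : Type*} {F₁ F₂ F₃ : Type*} {n : WithTop ℕ∞}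
  {E₁ : B → Type*}
  [∀ x, AddCommGroup (E₁ x)] [∀ x, Module ℝ (E₁ x)] [NormedAddCommGroup F₁] [NormedSpace ℝ F₁]
  [TopologicalSpace (TotalSpace F₁ E₁)] [∀ x, TopologicalSpace (E₁ x)]
  {E₂ : B → Type*} [∀ x, AddCommGroup (E₂ x)]
  [∀ x, Module ℝ (E₂ x)] [NormedAddCommGroup F₂] [NormedSpace ℝ F₂]
  [TopologicalSpace (TotalSpace F₂ E₂)] [∀ x, TopologicalSpace (E₂ x)]
  {E₃ : B → Type*} [∀ x, AddCommGroup (E₃ x)]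
  [∀ x, Module ℝ (E₃ x)] [NormedAddCommGroup F₃] [NormedSpace ℝ F₃]
  [TopologicalSpace (TotalSpace F₃ E₃)] [∀ x, TopologicalSpace (E₃ x)]
  {EB : Type*} [NormedAddCommGroup EB] [NormedSpace ℝ EB] {HB : Type*} [TopologicalSpace HB]
  {IB : ModelWithCorners ℝ EB HB} [TopologicalSpace B] [ChartedSpace HB B]
  [FiberBundle F₁ E₁] [VectorBundle ℝ F₁ E₁]
  [FiberBundle F₂ E₂] [VectorBundle ℝ F₂ E₂]
  [FiberBundle F₃ E₃] [VectorBundle ℝ F₃ E₃]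
  [∀ x, IsTopologicalAddGroup (E₂ x)] [∀ x, ContinuousSMul ℝ (E₂ x)]
  [∀ x, IsTopologicalAddGroup (E₃ x)] [∀ x, ContinuousSMul ℝ (E₃ x)]

/-- The composition of `C^n` sections of hom bundles is `C^n`. -/
theorem contMDiff_clm_bundle_comp {ψ : ∀ x, E₂ x →L[ℝ] E₃ x} {φ : ∀ x, E₁ x →L[ℝ] E₂ x}
    (hψ : ContMDiff IB (IB.prod 𝓘(ℝ, F₂ →L[ℝ] F₃)) n
      (fun m ↦ TotalSpace.mk' (F₂ →L[ℝ] F₃) (E := fun x ↦ E₂ x →L[ℝ] E₃ x) m (ψ m)))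
    (hφ : ContMDiff IB (IB.prod 𝓘(ℝ, F₁ →L[ℝ] F₂)) n
      (fun m ↦ TotalSpace.mk' (F₁ →L[ℝ] F₂) (E := fun x ↦ E₁ x →L[ℝ] E₂ x) m (φ m))) :
    ContMDiff IB (IB.prod 𝓘(ℝ, F₁ →L[ℝ] F₃)) n
      (fun m ↦ TotalSpace.mk' (F₁ →L[ℝ] F₃) (E := fun x ↦ E₁ x →L[ℝ] E₃ x) m
        ((ψ m).comp (φ m))) := by
  intro x
  have h1 := hψ x
  have h2 := hφ x
  rw [contMDiffAt_hom_bundle] at h1 h2 ⊢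
  refine ⟨contMDiffAt_id, (h1.2.clm_comp h2.2).congr_of_eventuallyEq ?_⟩
  -- The middle trivialization cancels against its inverse only over its base set, so the coordinate
  -- expressions agree only locally.
  filter_upwards [(trivializationAt F₂ E₂ x).open_baseSet.mem_nhds
    (FiberBundle.mem_baseSet_trivializationAt' x)] with m hm
  ext v
  simp only [ContinuousLinearMap.inCoordinates, ContinuousLinearMap.comp_apply]
  rw [Trivialization.symmL_continuousLinearMapAt _ hm]

end BundleComposition

section

variable {E : Type*} [NormedAddCommGroup E] [NormedSpace ℝ E]
  {M : Type*} [TopologicalSpace M] [ChartedSpace E M] [IsManifold 𝓘(ℝ, E) ∞ M]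

/-! ### Smoothness of the tensor operations -/

section Smoothness

/-- The coordinate expression of a covector field in the preferred trivialization at a point. -/
theorem smoothOneForm_iff {α : OneForm E M} :
    SmoothOneForm α ↔ ∀ x₀ : M, ContMDiffAt 𝓘(ℝ, E) 𝓘(ℝ, E →L[ℝ] ℝ) ∞
      (fun x : M => ((α x).comp
        ((trivializationAt E (TangentSpace 𝓘(ℝ, E)) x₀).symmL ℝ x) : E →L[ℝ] ℝ)) x₀ := by
  refine forall_congr' fun x₀ => ?_
  have := contMDiffAt_hom_bundle (IM := 𝓘(ℝ, E)) (IB := 𝓘(ℝ, E)) (n := ∞) (F₁ := E)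
    (E₁ := fun x : M => TangentSpace 𝓘(ℝ, E) x)
    (F₂ := ℝ) (E₂ := Bundle.Trivial M ℝ) (x₀ := x₀)
    (fun x : M => TotalSpace.mk' (E →L[ℝ] ℝ)
      (E := fun x : M => TangentSpace 𝓘(ℝ, E) x →L[ℝ] ℝ) x (α x))
  refine this.trans ?_
  simp only [ContinuousLinearMap.inCoordinates]
  constructor
  · intro h
    refine h.2.congr_of_eventuallyEq (Filter.Eventually.of_forall fun x => ?_)
    ext v
    simp
  · intro h
    refine ⟨contMDiffAt_id, h.congr_of_eventuallyEq (Filter.Eventually.of_forall fun x => ?_)⟩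
    ext v
    simp

theorem SmoothOneForm.apply {α : OneForm E M} {X : VectorField E M} (hα : SmoothOneForm α)
    (hX : SmoothVectorField X) : ContMDiff 𝓘(ℝ, E) 𝓘(ℝ, ℝ) ∞ (fun x => α x (X x)) := by
  intro x
  have h := ContMDiffAt.clm_bundle_apply (E₂ := Bundle.Trivial M ℝ) (F₂ := ℝ) (hα x) (hX x)
  rw [contMDiffAt_totalSpace] at h
  exact h.2

theorem SmoothSharpField.sharp {Λ : SharpField E M} {α : OneForm E M} (hΛ : SmoothSharpField Λ)
    (hα : SmoothOneForm α) : SmoothVectorField (sharp Λ α) :=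
  fun x => ContMDiffAt.clm_bundle_apply (hΛ x) (hα x)

theorem SmoothEndField.applyField {J : EndField E M} {X : VectorField E M} (hJ : SmoothEndField J)
    (hX : SmoothVectorField X) : SmoothVectorField (applyField J X) :=
  fun x => ContMDiffAt.clm_bundle_apply (hJ x) (hX x)

theorem SmoothEndField.transposeForm {J : EndField E M} {α : OneForm E M}
    (hJ : SmoothEndField J) (hα : SmoothOneForm α) : SmoothOneForm (transposeForm J α) :=
  contMDiff_clm_bundle_comp (E₃ := Bundle.Trivial M ℝ) hα hJ

theorem SmoothEndField.compField {J : EndField E M} {Λ : SharpField E M}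
    (hJ : SmoothEndField J) (hΛ : SmoothSharpField Λ) : SmoothSharpField (compField J Λ) :=
  contMDiff_clm_bundle_comp hJ hΛ

theorem smoothOneForm_differential {f : M → ℝ} (hf : ContMDiff 𝓘(ℝ, E) 𝓘(ℝ, ℝ) ∞ f) :
    SmoothOneForm (differential (E := E) f) := by
  rw [smoothOneForm_iff]
  intro x
  refine ((hf x).mfderiv_const (m := ∞) le_rfl).congr_of_eventuallyEq
    (Filter.Eventually.of_forall fun y => ?_)
  ext v
  simp [inTangentCoordinates, ContinuousLinearMap.inCoordinates, differential]
  rfl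

theorem SmoothSharpField.sub_smul {Λ Λ' : SharpField E M} (hΛ : SmoothSharpField Λ)
    (hΛ' : SmoothSharpField Λ') (l : ℝ) : SmoothSharpField (Λ - l • Λ') := by
  exact ContMDiff.sub_section hΛ (hΛ'.const_smul_section)

end Smoothness

end

section

variable {E : Type*} [NormedAddCommGroup E] [NormedSpace ℝ E]
  {M : Type*} [TopologicalSpace M] [ChartedSpace E M] [IsManifold 𝓘(ℝ, E) ∞ M]

/-! ### Cartan calculus in the preferred chart -/

section Cartan

variable [FiniteDimensional ℝ E]

/-- The expression of the vector field `X` in the preferred chart at `x`. -/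
def chartField (X : VectorField E M) (x : M) : E → E :=
  VectorField.mpullbackWithin 𝓘(ℝ, E) 𝓘(ℝ, E) (extChartAt 𝓘(ℝ, E) x).symm X
    (Set.range 𝓘(ℝ, E))

theorem isManifold_one : IsManifold 𝓘(ℝ, E) 1 M := IsManifold.of_le (n := ∞) (by simp)

theorem isManifold_two : IsManifold 𝓘(ℝ, E) 2 M := IsManifold.of_le (n := ∞) (by
  exact WithTop.coe_le_coe.2 le_top)

/-- The form is composed with the derivative of the inverse chart and the field with the inverse of
that derivative, so the two cancel. -/
theorem chartForm_chartField (α : OneForm E M) (X : VectorField E M) (x : M) {y : E}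
    (hy : y ∈ (extChartAt 𝓘(ℝ, E) x).target) :
    chartForm α x y (chartField X x y) = α ((extChartAt 𝓘(ℝ, E) x).symm y)
      (X ((extChartAt 𝓘(ℝ, E) x).symm y)) := by
  have := isManifold_one (E := E) (M := M)
  have h := isInvertible_mfderivWithin_extChartAt_symm (I := 𝓘(ℝ, E)) hy
  have h2 := h.self_apply_inverse (X ((extChartAt 𝓘(ℝ, E) x).symm y))
  rw [chartField, VectorField.mpullbackWithin_apply, chartForm]
  simp only [modelWithCornersSelf_coe, Set.range_id, mfderivWithin_univ] at h2 ⊢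
  exact congrArg _ h2

theorem chartForm_self (α : OneForm E M) (x : M) (v : E) :
    chartForm α x (extChartAt 𝓘(ℝ, E) x x) v = α x v := by
  have := isManifold_one (E := E) (M := M)
  have h := mfderivWithin_range_extChartAt_symm (I := 𝓘(ℝ, E)) (x := x)
  simp only [modelWithCornersSelf_coe, Set.range_id, mfderivWithin_univ] at h
  -- All tangent spaces are `E` by definition, so `v` can be fed to `α z` while `z` moves; this
  -- avoids rewriting a base point inside a dependent type.
  have key : ∀ z : M, z = x → (α z : E →L[ℝ] ℝ) v = (α x : E →L[ℝ] ℝ) v := by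
    rintro _ rfl
    rfl
  rw [chartForm, h]
  exact key _ (extChartAt_to_inv (I := 𝓘(ℝ, E)) x)

theorem chartField_self (X : VectorField E M) (x : M) :
    chartField X x (extChartAt 𝓘(ℝ, E) x x) = X x := by
  have := isManifold_one (E := E) (M := M)
  have h := mfderivWithin_extChartAt_symm_inverse_apply (I := 𝓘(ℝ, E)) (x := x)
  have key : ∀ z : M, z = x → (X z : E) = (X x : E) := by
    rintro _ rfl
    rfl
  exact (h _).trans (key _ (extChartAt_to_inv (I := 𝓘(ℝ, E)) x))

/-- Near the base point the inverse trivialization of the tangent bundle is the derivative of the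
inverse chart, so `chartForm` is the bundle coordinate expression composed with that inverse chart.
-/
theorem SmoothOneForm.contDiffAt_chartForm {α : OneForm E M} (hα : SmoothOneForm α) (x : M) :
    ContDiffAt ℝ ∞ (chartForm α x) (extChartAt 𝓘(ℝ, E) x x) := by
  have := isManifold_one (E := E) (M := M)
  have h := smoothOneForm_iff.1 hα x
  have ht := extChartAt_target_mem_nhds (I := 𝓘(ℝ, E)) x
  have hs := (contMDiffOn_extChartAt_symm (I := 𝓘(ℝ, E)) (n := ∞) x).contMDiffAt ht
  rw [← contMDiffAt_iff_contDiffAt]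
  refine (ContMDiffAt.comp_of_eq h hs (extChartAt_to_inv (I := 𝓘(ℝ, E)) x)).congr_of_eventuallyEq ?_
  filter_upwards [ht] with y hy
  have hy' := (extChartAt 𝓘(ℝ, E) x).map_target hy
  rw [extChartAt_source] at hy'
  rw [Function.comp_apply, TangentBundle.symmL_trivializationAt hy',
    (extChartAt 𝓘(ℝ, E) x).right_inv hy]
  simp only [modelWithCornersSelf_coe, Set.range_id, mfderivWithin_univ]
  rfl

theorem differential_apply {f : M → ℝ} (hf : ContMDiff 𝓘(ℝ, E) 𝓘(ℝ, ℝ) ∞ f) (x : M)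
    (v : TangentSpace 𝓘(ℝ, E) x) :
    differential (E := E) f x v =
      fderiv ℝ (f ∘ (extChartAt 𝓘(ℝ, E) x).symm) (extChartAt 𝓘(ℝ, E) x x) v := by
  have : MDifferentiableAt 𝓘(ℝ, E) 𝓘(ℝ, ℝ) f x := (hf x).mdifferentiableAt (by simp)
  simp only [differential, mfderiv, this, modelWithCornersSelf_coe, Set.range_id,
    fderivWithin_univ]
  rfl

theorem extDerivOneForm_apply (α : OneForm E M) (x : M) (u v : TangentSpace 𝓘(ℝ, E) x) :
    extDerivOneForm α x u v =
      fderiv ℝ (chartForm α x) (extChartAt 𝓘(ℝ, E) x x) u v -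
      fderiv ℝ (chartForm α x) (extChartAt 𝓘(ℝ, E) x x) v u := by
  have := isManifold_one (E := E) (M := M)
  rw [extDerivOneForm, mfderiv_extChartAt_self]
  rfl

theorem chartField_differentiableAt {X : VectorField E M} (hX : SmoothVectorField X) (x : M) :
    DifferentiableAt ℝ (chartField X x) (extChartAt 𝓘(ℝ, E) x x) := by
  have := isManifold_one (E := E) (M := M)
  have := isManifold_two (E := E) (M := M)
  have h := MDifferentiableWithinAt.differentiableWithinAt_mpullbackWithin_vectorField
    (I := 𝓘(ℝ, E)) (V := X) (s := Set.univ) (x := x)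
    ((hX x).mdifferentiableAt (by simp)).mdifferentiableWithinAt
  simp only [Set.preimage_univ, Set.univ_inter, modelWithCornersSelf_coe, Set.range_id] at h
  simp only [chartField, modelWithCornersSelf_coe, Set.range_id]
  exact differentiableWithinAt_univ.1 h

theorem mlieBracket_eq_lieBracket (X Y : VectorField E M) (x : M) :
    VectorField.mlieBracket 𝓘(ℝ, E) X Y x =
      VectorField.lieBracket ℝ (chartField X x) (chartField Y x) (extChartAt 𝓘(ℝ, E) x x) := by
  have := isManifold_one (E := E) (M := M)
  rw [VectorField.mlieBracket, VectorField.mlieBracketWithin_apply, mfderiv_extChartAt_self]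
  simp only [Set.preimage_univ, Set.univ_inter, modelWithCornersSelf_coe, Set.range_id, chartField]
  have h : ∀ w : E, (ContinuousLinearMap.id ℝ E).inverse w = w := fun w => by
    rw [ContinuousLinearMap.inverse_id, ContinuousLinearMap.id_apply]
  refine (h _).trans ?_
  exact congrFun VectorField.lieBracketWithin_univ _

/-- The Leibniz rule in the chart. Antisymmetrized in two fields, its second terms form the Lie
bracket, which is how Cartan's formula arises. -/
theorem differential_apply_form {α : OneForm E M} {Y : VectorField E M} (hα : SmoothOneForm α)
    (hY : SmoothVectorField Y) (x : M) (v : TangentSpace 𝓘(ℝ, E) x) :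
    differential (E := E) (fun y => α y (Y y)) x v =
      fderiv ℝ (chartForm α x) (extChartAt 𝓘(ℝ, E) x x) v (Y x) +
        α x (fderiv ℝ (chartField Y x) (extChartAt 𝓘(ℝ, E) x x) v) := by
  rw [differential_apply (hα.apply hY)]
  have h : (fun y => α y (Y y)) ∘ (extChartAt 𝓘(ℝ, E) x).symm =ᶠ[nhds (extChartAt 𝓘(ℝ, E) x x)]
      fun y => chartForm α x y (chartField Y x y) := by
    filter_upwards [extChartAt_target_mem_nhds (I := 𝓘(ℝ, E)) x] with y hy
    exact (chartForm_chartField α Y x hy).symm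
  have h1 := (hα.contDiffAt_chartForm x).differentiableAt (by simp)
  have h2 := chartField_differentiableAt hY x
  rw [h.fderiv_eq, fderiv_clm_apply h1 h2, ← chartForm_self α x, ← chartField_self Y x]
  exact add_comm _ _

/-- Cartan's formula for the exterior derivative of a 1-form. -/
theorem extDerivOneForm_eq {α : OneForm E M} {X Y : VectorField E M} (hα : SmoothOneForm α)
    (hX : SmoothVectorField X) (hY : SmoothVectorField Y) (x : M) :
    extDerivOneForm α x (X x) (Y x) =
      derivAlong X (fun y => α y (Y y)) x - derivAlong Y (fun y => α y (X y)) x -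
        α x (VectorField.mlieBracket 𝓘(ℝ, E) X Y x) := by
  rw [extDerivOneForm_apply, mlieBracket_eq_lieBracket, VectorField.lieBracket, derivAlong,
    derivAlong, differential_apply_form hα hX, differential_apply_form hα hY, chartField_self,
    chartField_self]
  erw [map_sub]
  ring

theorem lieDerivOneForm_apply {α : OneForm E M} {X Y : VectorField E M} (hα : SmoothOneForm α)
    (hX : SmoothVectorField X) (hY : SmoothVectorField Y) (x : M) :
    lieDerivOneForm X α x (Y x) = derivAlong X (fun y => α y (Y y)) x -
        α x (VectorField.mlieBracket 𝓘(ℝ, E) X Y x) := by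
  have := extDerivOneForm_eq hα hX hY x
  simp only [lieDerivOneForm, add_apply, this]
  simp only [derivAlong]
  ring

/-- Symmetry of the second derivative of `f` in the chart. -/
theorem extDerivOneForm_differential {f : M → ℝ} (hf : ContMDiff 𝓘(ℝ, E) 𝓘(ℝ, ℝ) ∞ f) (x : M)
    (u : TangentSpace 𝓘(ℝ, E) x) : extDerivOneForm (differential (E := E) f) x u = 0 := by
  ext v
  have ht := extChartAt_target_mem_nhds (I := 𝓘(ℝ, E)) x
  have hs := contMDiffOn_extChartAt_symm (I := 𝓘(ℝ, E)) (n := ∞) x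
  have h : chartForm (differential (E := E) f) x =ᶠ[nhds (extChartAt 𝓘(ℝ, E) x x)]
      fderiv ℝ (f ∘ (extChartAt 𝓘(ℝ, E) x).symm) := by
    filter_upwards [eventually_eventually_nhds.2 ht] with y hy
    have h1 := (hs.contMDiffAt hy).mdifferentiableAt (by simp)
    have h2 := (hf ((extChartAt 𝓘(ℝ, E) x).symm y)).mdifferentiableAt (by simp)
    rw [← mfderiv_eq_fderiv, mfderiv_comp _ h2 h1]
    rfl
  have hc : ContDiffAt ℝ ∞ (f ∘ (extChartAt 𝓘(ℝ, E) x).symm) (extChartAt 𝓘(ℝ, E) x x) :=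
    contMDiffAt_iff_contDiffAt.1 ((hf _).comp _ (hs.contMDiffAt ht))
  rw [extDerivOneForm_apply, h.fderiv_eq]
  have := (hc.isSymmSndFDerivAt (by
    rw [minSmoothness_of_isRCLikeNormedField]
    exact WithTop.coe_le_coe.2 le_top)) u v
  exact sub_eq_zero.2 this

theorem lieDerivOneForm_differential {f : M → ℝ} (hf : ContMDiff 𝓘(ℝ, E) 𝓘(ℝ, ℝ) ∞ f)
    (X : VectorField E M) :
    lieDerivOneForm X (differential f) = differential (derivAlong X f) := by
  funext x
  rw [lieDerivOneForm, extDerivOneForm_differential hf, zero_add]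
  rfl

theorem differential_mlieBracket {f : M → ℝ} {X Y : VectorField E M}
    (hf : ContMDiff 𝓘(ℝ, E) 𝓘(ℝ, ℝ) ∞ f)
    (hX : SmoothVectorField X) (hY : SmoothVectorField Y) (x : M) :
    differential (E := E) f x (VectorField.mlieBracket 𝓘(ℝ, E) X Y x) =
      derivAlong X (derivAlong Y f) x - derivAlong Y (derivAlong X f) x := by
  have h1 := lieDerivOneForm_apply (smoothOneForm_differential hf) hX hY x
  rw [lieDerivOneForm_differential hf] at h1
  have h2 : derivAlong X (fun y => differential (E := E) f y (Y y)) x =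
    derivAlong X (derivAlong Y f) x := rfl
  have h3 : differential (derivAlong X f) x (Y x) = derivAlong Y (derivAlong X f) x := rfl
  linarith

end Cartan

/-! ### Differentials of global functions separate tangent vectors -/

section Separation

variable [FiniteDimensional ℝ E] [T2Space M]

/-- The linear function `a` of the chart coordinates is extended to `M` by a bump function equal to
1 near `x`; the derivative of the preferred chart at `x` is the identity. -/
theorem exists_differential_eq (x : M) (a : E →L[ℝ] ℝ) :
    ∃ f : M → ℝ, ContMDiff 𝓘(ℝ, E) 𝓘(ℝ, ℝ) ∞ f ∧ differential (E := E) f x = a := by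
  obtain ⟨b⟩ : Nonempty (SmoothBumpFunction 𝓘(ℝ, E) x) := inferInstance
  let g : M → ℝ := fun y => a (extChartAt 𝓘(ℝ, E) x y)
  have hg : ContMDiffOn 𝓘(ℝ, E) 𝓘(ℝ, ℝ) ∞ g (chartAt E x).source :=
    (a.contMDiff).comp_contMDiffOn
      (contMDiffOn_extChartAt (I := 𝓘(ℝ, E)) (x := x))
  refine ⟨fun y => b y • g y, b.contMDiff_smul hg, ?_⟩
  have h : (fun y => b y • g y) =ᶠ[nhds x] g := by
    filter_upwards [b.eventuallyEq_one] with y hy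
    simp [hy]
  have := isManifold_one (E := E) (M := M)
  have hd : MDifferentiableAt 𝓘(ℝ, E) 𝓘(ℝ, E) (extChartAt 𝓘(ℝ, E) x) x :=
    mdifferentiableAt_extChartAt (mem_chart_source E x)
  rw [differential, h.mfderiv_eq]
  change mfderiv 𝓘(ℝ, E) 𝓘(ℝ, ℝ) (a ∘ (extChartAt 𝓘(ℝ, E) x)) x = a
  rw [mfderiv_comp x a.mdifferentiableAt hd, mfderiv_extChartAt_self,
    ContinuousLinearMap.mfderiv_eq]
  rfl

theorem eq_of_differential_eq {x : M} {u v : TangentSpace 𝓘(ℝ, E) x}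
    (h : ∀ f : M → ℝ, ContMDiff 𝓘(ℝ, E) 𝓘(ℝ, ℝ) ∞ f →
      differential (E := E) f x u = differential (E := E) f x v) : u = v := by
  have : ∀ a : E →L[ℝ] ℝ, a u = a v := fun a => by
    obtain ⟨f, hf, rfl⟩ := exists_differential_eq x a
    exact h f hf
  by_contra hne
  obtain ⟨a, ha⟩ := SeparatingDual.exists_separating_of_ne (R := ℝ) (V := E) hne
  exact ha (this a)

end Separation

end

section

variable {E : Type*} [NormedAddCommGroup E] [NormedSpace ℝ E] [FiniteDimensional ℝ E]
  {M : Type*} [TopologicalSpace M] [ChartedSpace E M] [IsManifold 𝓘(ℝ, E) ∞ M]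

/-! ### Brackets of functions and the Jacobi identity -/

section Brackets

/-- The bracket `{f, g} = Λ(df, dg)` of functions. -/
abbrev bracket (Λ : SharpField E M) (f g : M → ℝ) : M → ℝ :=
  pairing Λ (differential f) (differential g)

/-- The Hamiltonian vector field `Λ df`. -/
abbrev hamiltonian (Λ : SharpField E M) (f : M → ℝ) : VectorField E M :=
  sharp Λ (differential f)

theorem differential_sub_smul {f g : M → ℝ} (hf : ContMDiff 𝓘(ℝ, E) 𝓘(ℝ, ℝ) ∞ f)
    (hg : ContMDiff 𝓘(ℝ, E) 𝓘(ℝ, ℝ) ∞ g) (l : ℝ) :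
    differential (E := E) (f - l • g) = differential f - l • differential g := by
  funext x
  have h1 := (hf x).mdifferentiableAt (by simp)
  have h2 := (hg x).mdifferentiableAt (by simp)
  exact ((h1.hasMFDerivAt).sub ((h2.hasMFDerivAt).const_smul l)).mfderiv

theorem differential_neg (f : M → ℝ) :
    differential (E := E) (-f) = -differential f := by
  funext x
  exact mfderiv_neg

theorem derivAlong_neg (X : VectorField E M) (f : M → ℝ) :
    derivAlong X (-f) = -derivAlong X f := by
  funext x
  simp only [derivAlong, differential_neg]
  rfl

theorem derivAlong_sub_smul (X : VectorField E M) {f g : M → ℝ}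
    (hf : ContMDiff 𝓘(ℝ, E) 𝓘(ℝ, ℝ) ∞ f) (hg : ContMDiff 𝓘(ℝ, E) 𝓘(ℝ, ℝ) ∞ g) (l : ℝ) :
    derivAlong X (f - l • g) = derivAlong X f - l • derivAlong X g := by
  funext x
  simp only [derivAlong, differential_sub_smul hf hg]
  rfl

theorem contMDiff_derivAlong {X : VectorField E M} {f : M → ℝ} (hX : SmoothVectorField X)
    (hf : ContMDiff 𝓘(ℝ, E) 𝓘(ℝ, ℝ) ∞ f) : ContMDiff 𝓘(ℝ, E) 𝓘(ℝ, ℝ) ∞ (derivAlong X f) :=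
  (smoothOneForm_differential hf).apply hX

theorem SmoothSharpField.hamiltonian {Λ : SharpField E M} {f : M → ℝ} (hΛ : SmoothSharpField Λ)
    (hf : ContMDiff 𝓘(ℝ, E) 𝓘(ℝ, ℝ) ∞ f) : SmoothVectorField (hamiltonian Λ f) :=
  hΛ.sharp (smoothOneForm_differential hf)

theorem SmoothSharpField.bracket {Λ : SharpField E M} {f g : M → ℝ} (hΛ : SmoothSharpField Λ)
    (hf : ContMDiff 𝓘(ℝ, E) 𝓘(ℝ, ℝ) ∞ f) (hg : ContMDiff 𝓘(ℝ, E) 𝓘(ℝ, ℝ) ∞ g) :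
    ContMDiff 𝓘(ℝ, E) 𝓘(ℝ, ℝ) ∞ (bracket Λ f g) :=
  contMDiff_derivAlong (hΛ.hamiltonian hf) hg

theorem IsBivectorField.bracket_swap {Λ : SharpField E M} (hΛ : IsBivectorField Λ) (f g : M → ℝ) :
    bracket Λ f g = -bracket Λ g f := by
  funext x
  exact eq_neg_of_add_eq_zero_left (hΛ.2 x _ _)

theorem IsBivectorField.derivAlong_bracket_swap {Λ : SharpField E M} (hΛ : IsBivectorField Λ)
    (X : VectorField E M) (f g : M → ℝ) (x : M) :
    derivAlong X (bracket Λ f g) x = -derivAlong X (bracket Λ g f) x := by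
  rw [hΛ.bracket_swap f g, derivAlong_neg]
  rfl

theorem IsBivectorField.nested_eq {Λ : SharpField E M} (hΛ : IsBivectorField Λ)
    (Λ' : SharpField E M) (f g h : M → ℝ) (x : M) :
    nested Λ Λ' f g h x = -derivAlong (hamiltonian Λ h) (bracket Λ' f g) x :=
  congrFun (hΛ.bracket_swap (bracket Λ' f g) h) x

/-- The Jacobi identity for the bracket of functions. -/
theorem IsBivectorField.isPoisson_iff {Λ : SharpField E M} (hΛ : IsBivectorField Λ) :
    IsPoisson Λ ↔ ∀ f g h : M → ℝ, ContMDiff 𝓘(ℝ, E) 𝓘(ℝ, ℝ) ∞ f →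
      ContMDiff 𝓘(ℝ, E) 𝓘(ℝ, ℝ) ∞ g → ContMDiff 𝓘(ℝ, E) 𝓘(ℝ, ℝ) ∞ h → ∀ x,
      derivAlong (hamiltonian Λ f) (bracket Λ g h) x +
        derivAlong (hamiltonian Λ g) (bracket Λ h f) x +
        derivAlong (hamiltonian Λ h) (bracket Λ f g) x = 0 := by
  -- The factor 2 comes from the two equal halves of `[Λ, Λ]`, the sign from moving the outer
  -- function into the Hamiltonian slot.
  have key : ∀ f g h x, schoutenBivectorBivector Λ Λ f g h x =
      -2 * (derivAlong (hamiltonian Λ f) (bracket Λ g h) x +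
        derivAlong (hamiltonian Λ g) (bracket Λ h f) x +
        derivAlong (hamiltonian Λ h) (bracket Λ f g) x) := fun f g h x => by
    simp only [schoutenBivectorBivector, Pi.add_apply, hΛ.nested_eq]
    ring
  constructor
  · intro H f g h hf hg hh x
    have := congrFun (H.2 f g h hf hg hh) x
    rw [key] at this
    simp only [Pi.zero_apply] at this
    linarith
  · intro H
    refine ⟨hΛ, fun f g h hf hg hh => funext fun x => ?_⟩
    rw [key, H f g h hf hg hh]
    simp

end Brackets

/-! ### Homogeneity and the commutator of `L_Z` with `ᵗJ` -/

section Homogeneity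

variable [T2Space M]

/-- Paired with `dh`, this is the Jacobi identity for `f, g, h`. -/
theorem IsPoisson.mlieBracket_hamiltonian {P : SharpField E M} (hP : IsPoisson P) {f g : M → ℝ}
    (hf : ContMDiff 𝓘(ℝ, E) 𝓘(ℝ, ℝ) ∞ f) (hg : ContMDiff 𝓘(ℝ, E) 𝓘(ℝ, ℝ) ∞ g) (x : M) :
    VectorField.mlieBracket 𝓘(ℝ, E) (hamiltonian P f) (hamiltonian P g) x =
      hamiltonian P (bracket P f g) x := by
  refine eq_of_differential_eq fun h hh => ?_
  rw [differential_mlieBracket hh (hP.1.1.hamiltonian hf) (hP.1.1.hamiltonian hg)]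
  have h1 := hP.1.isPoisson_iff.1 hP f g h hf hg hh x
  have h2 : differential h x (hamiltonian P (bracket P f g) x) = _ := hP.1.nested_eq P f g h x
  rw [h2]
  change derivAlong (hamiltonian P f) (bracket P g h) x -
    derivAlong (hamiltonian P g) (bracket P f h) x = _
  rw [hP.1.derivAlong_bracket_swap _ f h]
  linarith

/-- Pairing `[Z, Λ df]` with `dg` gives `Z{f, g} - {f, Zg}`; subtracting `{Zf, g}` leaves `[Z,
Λ](df, dg)`. -/
theorem isHomogeneous_iff {Λ : SharpField E M} {Z : VectorField E M} (hΛ : SmoothSharpField Λ)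
    (hZ : SmoothVectorField Z) :
    IsHomogeneous Λ Z ↔ ∀ f : M → ℝ, ContMDiff 𝓘(ℝ, E) 𝓘(ℝ, ℝ) ∞ f → ∀ x,
      VectorField.mlieBracket 𝓘(ℝ, E) Z (hamiltonian Λ f) x =
        hamiltonian Λ (derivAlong Z f) x - hamiltonian Λ f x := by
  have key : ∀ f g : M → ℝ, ContMDiff 𝓘(ℝ, E) 𝓘(ℝ, ℝ) ∞ f → ContMDiff 𝓘(ℝ, E) 𝓘(ℝ, ℝ) ∞ g →
      ∀ x, differential (E := E) g x (VectorField.mlieBracket 𝓘(ℝ, E) Z (hamiltonian Λ f) x) -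
        differential g x (hamiltonian Λ (derivAlong Z f) x - hamiltonian Λ f x) =
        schoutenVectorBivector Z Λ f g x - -bracket Λ f g x := by
    intro f g hf hg x
    rw [differential_mlieBracket hg hZ (hΛ.hamiltonian hf), map_sub]
    change derivAlong Z (bracket Λ f g) x - _ - _ = _
    simp only [schoutenVectorBivector, Pi.sub_apply, derivAlong, pairing, sharp]
    ring
  constructor
  · intro H f hf x
    refine eq_of_differential_eq fun g hg => ?_
    rw [← sub_eq_zero, key f g hf hg, H f g hf hg]
    simp
  · intro H f g hf hg
    funext x
    have := key f g hf hg x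
    rw [H f hf, sub_self] at this
    exact (sub_eq_zero.1 this.symm)

/-- The defect `[Z, JX] - J[Z, X]`, paired with `α`, computes `L_Z ᵗJ α - ᵗJ L_Z α` on `X`. -/
theorem lieDeriv_transpose_apply {J : EndField E M} {Z X : VectorField E M} {α : OneForm E M}
    (hJ : SmoothEndField J) (hZ : SmoothVectorField Z) (hX : SmoothVectorField X)
    (hα : SmoothOneForm α) (x : M) :
    (lieDerivOneForm Z (transposeForm J α) - transposeForm J (lieDerivOneForm Z α)) x (X x) =
      α x (VectorField.mlieBracket 𝓘(ℝ, E) Z (applyField J X) x) -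
        α x (J x (VectorField.mlieBracket 𝓘(ℝ, E) Z X x)) := by
  have h1 := lieDerivOneForm_apply (hJ.transposeForm hα) hZ hX x
  have h2 := lieDerivOneForm_apply hα hZ (hJ.applyField hX) x
  have h3 : (transposeForm J (lieDerivOneForm Z α)) x (X x) =
    lieDerivOneForm Z α x (applyField J X x) := rfl
  have h4 : (lieDerivOneForm Z (transposeForm J α) - transposeForm J (lieDerivOneForm Z α)) x (X x)
    = lieDerivOneForm Z (transposeForm J α) x (X x) -
      (transposeForm J (lieDerivOneForm Z α)) x (X x) := rfl
  rw [h4, h3, h1, h2]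
  simp only [transposeForm, applyField, ContinuousLinearMap.comp_apply]
  ring

/-- By skew-symmetry, pairing `P ω` with `df` is minus evaluating `ω` on `P df`, and for the
commutator form `ω` that value is known from `lieDeriv_transpose_apply`. -/
theorem sharp_lieDeriv_transpose_iff {P : SharpField E M} {J : EndField E M} {Z : VectorField E M}
    (hP : IsBivectorField P) (hJ : SmoothEndField J) (hZ : SmoothVectorField Z) :
    (∀ α : OneForm E M, SmoothOneForm α → sharp P
      (lieDerivOneForm Z (transposeForm J α) - transposeForm J (lieDerivOneForm Z α)) = 0) ↔
    ∀ f : M → ℝ, ContMDiff 𝓘(ℝ, E) 𝓘(ℝ, ℝ) ∞ f → ∀ x,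
      VectorField.mlieBracket 𝓘(ℝ, E) Z (hamiltonian (compField J P) f) x =
        J x (VectorField.mlieBracket 𝓘(ℝ, E) Z (hamiltonian P f) x) := by
  have key : ∀ α : OneForm E M, SmoothOneForm α → ∀ f : M → ℝ,
      ContMDiff 𝓘(ℝ, E) 𝓘(ℝ, ℝ) ∞ f → ∀ x, differential f x (sharp P
        (lieDerivOneForm Z (transposeForm J α) - transposeForm J (lieDerivOneForm Z α)) x) =
      -(α x (VectorField.mlieBracket 𝓘(ℝ, E) Z (hamiltonian (compField J P) f) x) -
        α x (J x (VectorField.mlieBracket 𝓘(ℝ, E) Z (hamiltonian P f) x))) := by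
    intro α hα f hf x
    have h1 := lieDeriv_transpose_apply hJ hZ (hP.1.hamiltonian hf) hα x
    have h2 := hP.2 x (differential f x)
      ((lieDerivOneForm Z (transposeForm J α) - transposeForm J (lieDerivOneForm Z α)) x)
    exact (eq_neg_of_add_eq_zero_left h2).trans (congrArg _ h1)
  constructor
  · intro H f hf x
    refine eq_of_differential_eq fun g hg => ?_
    have := key _ (smoothOneForm_differential hg) f hf x
    rw [H _ (smoothOneForm_differential hg), Pi.zero_apply, map_zero] at this
    linarith
  · intro H α hα
    funext x
    refine eq_of_differential_eq fun f hf => ?_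
    rw [key α hα f hf, H f hf]
    simp

theorem isHomogeneous_compField_iff {P : SharpField E M} {J : EndField E M} {Z : VectorField E M}
    (hP : IsBivectorField P) (hJ : SmoothEndField J) (hZ : SmoothVectorField Z)
    (hPZ : IsHomogeneous P Z) :
    IsHomogeneous (compField J P) Z ↔
    ∀ α : OneForm E M, SmoothOneForm α → sharp P
      (lieDerivOneForm Z (transposeForm J α) - transposeForm J (lieDerivOneForm Z α)) = 0 := by
  rw [isHomogeneous_iff (hJ.compField hP.1) hZ, sharp_lieDeriv_transpose_iff hP hJ hZ]
  refine forall_congr' fun f => forall_congr' fun hf => forall_congr' fun x => ?_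
  rw [(isHomogeneous_iff hP.1 hZ).1 hPZ f hf x, map_sub]
  rfl

end Homogeneity

/-! ### Pointwise form of `J ∘ P = P ∘ ᵗJ` -/

section Compatibility

variable [T2Space M]

/-- Compatibility speaks of smooth global forms; it descends to a single covector because that
covector is the value of a differential. -/
theorem IsCompatible.comp_apply {P : SharpField E M} {J : EndField E M} (hPJ : IsCompatible P J)
    (x : M) (a : TangentSpace 𝓘(ℝ, E) x →L[ℝ] ℝ) : P x (a.comp (J x)) = J x (P x a) := by
  obtain ⟨f, hf, rfl⟩ := exists_differential_eq (E := E) x a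
  exact (congrFun (hPJ.1 _ (smoothOneForm_differential hf)) x).symm

theorem IsBivectorField.compField {P : SharpField E M} {J : EndField E M}
    (hP : IsBivectorField P) (hJ : SmoothEndField J)
    (h : ∀ (x : M) (a : TangentSpace 𝓘(ℝ, E) x →L[ℝ] ℝ), P x (a.comp (J x)) = J x (P x a)) :
    IsBivectorField (compField J P) := by
  refine ⟨hJ.compField hP.1, fun x a b => ?_⟩
  have := hP.2 x (a.comp (J x)) b
  rw [h x a] at this
  exact this

end Compatibility

end

section

variable {E : Type*} [NormedAddCommGroup E] [NormedSpace ℝ E] [FiniteDimensional ℝ E]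
  {M : Type*} [TopologicalSpace M] [T2Space M] [ChartedSpace E M] [IsManifold 𝓘(ℝ, E) ∞ M]

/-! ### The concomitant on exact forms and on their transposes -/

section Concomitant

/-- The bracket `{α, dg}_Λ` is `-L_{Λ dg} α`. -/
theorem formBracket_differential_right (Λ : SharpField E M) (α : OneForm E M) {g : M → ℝ}
    (hg : ContMDiff 𝓘(ℝ, E) 𝓘(ℝ, ℝ) ∞ g) :
    formBracket Λ α (differential g) = -lieDerivOneForm (hamiltonian Λ g) α := by
  have h : differential (E := E) (derivAlong (sharp Λ α) g) =
    differential (pairing Λ α (differential g)) := rfl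
  rw [formBracket, lieDerivOneForm_differential hg, h]
  abel

theorem formBracket_swap {Λ : SharpField E M} (hΛ : IsBivectorField Λ) (α β : OneForm E M) :
    formBracket Λ α β = -formBracket Λ β α := by
  have h : pairing Λ α β = -pairing Λ β α := funext fun x =>
    eq_neg_of_add_eq_zero_left (hΛ.2 x _ _)
  rw [formBracket, formBracket, h, differential_neg]
  abel

theorem formBracket_differential {Λ : SharpField E M} (hΛ : IsBivectorField Λ) {f g : M → ℝ}
    (hf : ContMDiff 𝓘(ℝ, E) 𝓘(ℝ, ℝ) ∞ f) (hg : ContMDiff 𝓘(ℝ, E) 𝓘(ℝ, ℝ) ∞ g) :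
    formBracket Λ (differential f) (differential g) = differential (bracket Λ f g) := by
  rw [formBracket_differential_right Λ _ hg, lieDerivOneForm_differential hf, ← differential_neg]
  exact congrArg _ (hΛ.bracket_swap f g).symm

variable {P : SharpField E M} {J : EndField E M}

theorem lieDerivOneForm_transposeForm_apply (hJ : SmoothEndField J) {α : OneForm E M}
    {X V : VectorField E M} (hα : SmoothOneForm α) (hX : SmoothVectorField X)
    (hV : SmoothVectorField V) (x : M) :
    lieDerivOneForm X (transposeForm J α) x (V x) =
      derivAlong X (fun y => α y (applyField J V y)) x -
        α x (J x (VectorField.mlieBracket 𝓘(ℝ, E) X V x)) :=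
  lieDerivOneForm_apply (hJ.transposeForm hα) hX hV x

/-- Brackets of exact forms are exact, and a bracket with one exact entry is a Lie derivative along
a Hamiltonian field up to sign, so `C(P, J)(df, dg)` on `V` involves only derivatives of functions
and Lie brackets of fields. -/
theorem concomitant_differential_apply (hP : IsBivectorField P) (hJ : SmoothEndField J)
    (hPJ : IsCompatible P J) {f g : M → ℝ} {V : VectorField E M}
    (hf : ContMDiff 𝓘(ℝ, E) 𝓘(ℝ, ℝ) ∞ f) (hg : ContMDiff 𝓘(ℝ, E) 𝓘(ℝ, ℝ) ∞ g)
    (hV : SmoothVectorField V) (x : M) :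
    derivAlong V (bracket (compField J P) f g) x +
      (derivAlong (hamiltonian P g) (derivAlong (applyField J V) f) x -
        differential f x (J x (VectorField.mlieBracket 𝓘(ℝ, E) (hamiltonian P g) V x))) -
      (derivAlong (hamiltonian P f) (derivAlong (applyField J V) g) x -
        differential g x (J x (VectorField.mlieBracket 𝓘(ℝ, E) (hamiltonian P f) V x))) +
      derivAlong (applyField J V) (bracket P f g) x = 0 := by
  have hf' := smoothOneForm_differential hf
  have hg' := smoothOneForm_differential hg
  have h := congrFun (hPJ.2 _ _ hf' hg') x
  rw [concomitant, formBracket_differential (hP.compField hJ hPJ.comp_apply) hf hg,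
    formBracket_differential hP hf hg, formBracket_differential_right P _ hg, formBracket_swap hP,
    formBracket_differential_right P _ hf] at h
  have h' := congrArg (fun a : E →L[ℝ] ℝ => a (V x)) h
  have h1 : _ = derivAlong (hamiltonian P g) (derivAlong (applyField J V) f) x - _ :=
    lieDerivOneForm_transposeForm_apply hJ hf' (hP.1.hamiltonian hg) hV x
  have h2 : _ = derivAlong (hamiltonian P f) (derivAlong (applyField J V) g) x - _ :=
    lieDerivOneForm_transposeForm_apply hJ hg' (hP.1.hamiltonian hf) hV x
  change differential (bracket (compField J P) f g) x (V x) -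
    (-(lieDerivOneForm (hamiltonian P g) (transposeForm J (differential f)) x (V x)) +
      - -(lieDerivOneForm (hamiltonian P f) (transposeForm J (differential g)) x (V x)) -
      differential (bracket P f g) x (J x (V x))) = 0 at h'
  rw [h1, h2] at h'
  have h3 : differential (bracket (compField J P) f g) x (V x) =
    derivAlong V (bracket (compField J P) f g) x := rfl
  have h4 : differential (bracket P f g) x (J x (V x)) =
    derivAlong (applyField J V) (bracket P f g) x := rfl
  rw [h3, h4] at h'
  linarith

/-- This is `C(P, J)(ᵗJ df, dg)` on `V`. Since `P ᵗJ df = J P df`, the fields that occur are again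
Hamiltonian. The terms with `L_{J P dg} (ᵗJ df)` cancel, as do the derivatives of `(J²V) f` along `P
dg`. -/
theorem concomitant_transpose_apply (hP : IsBivectorField P) (hJ : SmoothEndField J)
    (hPJ : IsCompatible P J) {f g : M → ℝ} {V : VectorField E M}
    (hf : ContMDiff 𝓘(ℝ, E) 𝓘(ℝ, ℝ) ∞ f) (hg : ContMDiff 𝓘(ℝ, E) 𝓘(ℝ, ℝ) ∞ g)
    (hV : SmoothVectorField V) (x : M) :
    differential g x (J x (VectorField.mlieBracket 𝓘(ℝ, E)
        (hamiltonian (compField J P) f) V x)) +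
      differential f x (J x (VectorField.mlieBracket 𝓘(ℝ, E)
        (hamiltonian P g) (applyField J V) x)) -
      differential f x (J x (J x (VectorField.mlieBracket 𝓘(ℝ, E) (hamiltonian P g) V x))) -
      derivAlong (hamiltonian (compField J P) f) (derivAlong (applyField J V) g) x +
      derivAlong V (bracket (compField J (compField J P)) f g) x = 0 := by
  have hf' := smoothOneForm_differential hf
  have hg' := smoothOneForm_differential hg
  have hJf := hJ.transposeForm hf'
  have hQ := hP.compField hJ hPJ.comp_apply
  have h := congrFun (hPJ.2 _ _ hJf hg') x
  rw [concomitant, formBracket_differential_right _ _ hg, formBracket_differential_right _ _ hg,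
    formBracket_differential_right _ _ hg] at h
  have h' := congrArg (fun a : E →L[ℝ] ℝ => a (V x)) h
  have e : sharp P (transposeForm J (differential f)) = hamiltonian (compField J P) f :=
    (hPJ.1 _ hf').symm
  have e2 : pairing P (transposeForm J (differential f)) (transposeForm J (differential g)) =
      bracket (compField J (compField J P)) f g := by
    funext y
    exact congrArg (fun w : E => (differential (E := E) g y : E →L[ℝ] ℝ) ((J y : E →L[ℝ] E) w))
      (congrFun e y)
  have hXf := hQ.1.hamiltonian hf
  have hXg := hP.1.hamiltonian hg
  have h1 : _ = derivAlong (hamiltonian P g)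
      (derivAlong (applyField J (applyField J V)) f) x - _ :=
    lieDerivOneForm_transposeForm_apply hJ hJf hXg hV x
  have h2 : _ = derivAlong (hamiltonian (compField J P) f) (derivAlong (applyField J V) g) x - _ :=
    lieDerivOneForm_transposeForm_apply hJ hg' hXf hV x
  have h3 : _ = derivAlong (hamiltonian P g)
      (derivAlong (applyField J (applyField J V)) f) x - _ :=
    lieDerivOneForm_transposeForm_apply hJ hf' hXg (hJ.applyField hV) x
  rw [formBracket, e, e2, hPJ.1 _ hg' |>.symm] at h'
  change -(lieDerivOneForm (hamiltonian (compField J P) g) (transposeForm J (differential f)) x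
      (V x)) -
    (-(lieDerivOneForm (hamiltonian P g) (transposeForm J (transposeForm J (differential f))) x
      (V x)) +
      (lieDerivOneForm (hamiltonian (compField J P) f) (transposeForm J (differential g)) x (V x) -
      lieDerivOneForm (hamiltonian (compField J P) g) (transposeForm J (differential f)) x (V x) -
      derivAlong V (bracket (compField J (compField J P)) f g) x) -
      -(lieDerivOneForm (hamiltonian P g) (transposeForm J (differential f)) x
        (applyField J V x))) = 0 at h'
  rw [h1, h2, h3] at h'
  have h4 : transposeForm J (differential f) x
      (J x (VectorField.mlieBracket 𝓘(ℝ, E) (hamiltonian P g) V x)) =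
    differential f x (J x (J x (VectorField.mlieBracket 𝓘(ℝ, E) (hamiltonian P g) V x))) := rfl
  rw [h4] at h'
  linarith

end Concomitant

/-! ### The Poisson property of `J P` and of the pencil -/

section PoissonNijenhuis

variable {P : SharpField E M} {J : EndField E M}

/-- `P` and `J P` commute for the Schouten bracket. -/
theorem bracket_compField_cyclic (hP : IsPoisson P) (hJ : SmoothEndField J)
    (hPJ : IsCompatible P J) {f g h : M → ℝ} (hf : ContMDiff 𝓘(ℝ, E) 𝓘(ℝ, ℝ) ∞ f)
    (hg : ContMDiff 𝓘(ℝ, E) 𝓘(ℝ, ℝ) ∞ g) (hh : ContMDiff 𝓘(ℝ, E) 𝓘(ℝ, ℝ) ∞ h) (x : M) :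
    derivAlong (hamiltonian P f) (bracket (compField J P) g h) x +
      derivAlong (hamiltonian P g) (bracket (compField J P) h f) x +
      derivAlong (hamiltonian P h) (bracket (compField J P) f g) x +
      (derivAlong (hamiltonian (compField J P) f) (bracket P g h) x +
        derivAlong (hamiltonian (compField J P) g) (bracket P h f) x +
        derivAlong (hamiltonian (compField J P) h) (bracket P f g) x) = 0 := by
  have hQ := hP.1.compField hJ hPJ.comp_apply
  -- With `V = P dh` the Lie brackets are Hamiltonian fields of `P`, so only brackets of functions
  -- remain.
  have H := concomitant_differential_apply hP.1 hJ hPJ hf hg (hP.1.1.hamiltonian hh) x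
  rw [hP.mlieBracket_hamiltonian hg hh, hP.mlieBracket_hamiltonian hf hh] at H
  have e1 : differential f x (J x (hamiltonian P (bracket P g h) x)) = _ :=
    hQ.nested_eq P g h f x
  have e2 : differential g x (J x (hamiltonian P (bracket P f h) x)) = _ :=
    hQ.nested_eq P f h g x
  rw [e1, e2, hP.1.derivAlong_bracket_swap _ f h] at H
  change derivAlong (hamiltonian P h) (bracket (compField J P) f g) x +
    (derivAlong (hamiltonian P g) (bracket (compField J P) h f) x - _) -
    (derivAlong (hamiltonian P f) (bracket (compField J P) h g) x - _) +
    derivAlong (hamiltonian (compField J P) h) (bracket P f g) x = 0 at H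
  rw [hQ.derivAlong_bracket_swap _ h g] at H
  linarith

theorem nijenhuisTorsion_apply (J : EndField E M) (X Y : VectorField E M) (x : M) :
    nijenhuisTorsion J X Y x =
      VectorField.mlieBracket 𝓘(ℝ, E) (applyField J X) (applyField J Y) x -
      J x (VectorField.mlieBracket 𝓘(ℝ, E) (applyField J X) Y x) -
      J x (VectorField.mlieBracket 𝓘(ℝ, E) X (applyField J Y) x) +
      J x (J x (VectorField.mlieBracket 𝓘(ℝ, E) X Y x)) := rfl

/-- The torsion identity `hT` alone leaves both the mixed terms `T` and a term in `J² P`; the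
concomitant on `J P dh` (`hA`) and its transposed version on `P dh` (`hB`) supply the relations that
remove them. -/
theorem isPoisson_compField (hP : IsPoisson P) (hJ : IsNijenhuisTensor J)
    (hPJ : IsCompatible P J) : IsPoisson (compField J P) := by
  have hQ := hP.1.compField hJ.1 hPJ.comp_apply
  have hR := hQ.compField hJ.1 fun x a => congrArg (J x) (hPJ.comp_apply x a)
  let T : (M → ℝ) → (M → ℝ) → (M → ℝ) → M → ℝ := fun f g h x =>
    differential f x (J x (VectorField.mlieBracket 𝓘(ℝ, E) (hamiltonian P g)
      (hamiltonian (compField J P) h) x))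
  have hT : ∀ {f g h : M → ℝ}, ContMDiff 𝓘(ℝ, E) 𝓘(ℝ, ℝ) ∞ f →
      ContMDiff 𝓘(ℝ, E) 𝓘(ℝ, ℝ) ∞ g → ContMDiff 𝓘(ℝ, E) 𝓘(ℝ, ℝ) ∞ h → ∀ x,
      T f g h x - T f h g x =
        derivAlong (hamiltonian (compField J P) g) (bracket (compField J P) h f) x +
        derivAlong (hamiltonian (compField J P) h) (bracket (compField J P) f g) x -
        derivAlong (hamiltonian (compField J (compField J P)) f) (bracket P g h) x := by
    intro f g h hf hg hh x
    have H := congrFun (hJ.2 _ _ (hP.1.1.hamiltonian hg) (hP.1.1.hamiltonian hh)) x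
    rw [nijenhuisTorsion_apply, hP.mlieBracket_hamiltonian hg hh] at H
    have H' := congrArg (differential (E := E) f x) H
    rw [map_add, map_sub, map_sub, Pi.zero_apply, map_zero] at H'
    have e0 := differential_mlieBracket hf (hQ.1.hamiltonian hg) (hQ.1.hamiltonian hh) x
    have e1 : differential f x (J x (J x (hamiltonian P (bracket P g h) x))) = _ :=
      hR.nested_eq P g h f x
    have e2 : differential f x (J x (VectorField.mlieBracket 𝓘(ℝ, E)
        (applyField J (hamiltonian P g)) (hamiltonian P h) x)) = -T f h g x := by
      rw [VectorField.mlieBracket_swap_apply, map_neg, map_neg]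
      rfl
    have e3 : derivAlong (hamiltonian (compField J P) h)
        (derivAlong (hamiltonian (compField J P) g) f) x = _ :=
      hQ.derivAlong_bracket_swap _ g f x
    rw [e1, e2] at H'
    change differential f x (VectorField.mlieBracket 𝓘(ℝ, E) (hamiltonian (compField J P) g)
      (hamiltonian (compField J P) h) x) - -T f h g x - T f g h x + _ = 0 at H'
    rw [e0, e3] at H'
    change derivAlong (hamiltonian (compField J P) g) (bracket (compField J P) h f) x - _ -
      _ - _ + _ = 0 at H'
    linarith
  have hA : ∀ {f g h : M → ℝ}, ContMDiff 𝓘(ℝ, E) 𝓘(ℝ, ℝ) ∞ f →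
      ContMDiff 𝓘(ℝ, E) 𝓘(ℝ, ℝ) ∞ g → ContMDiff 𝓘(ℝ, E) 𝓘(ℝ, ℝ) ∞ h → ∀ x,
      derivAlong (hamiltonian (compField J P) h) (bracket (compField J P) f g) x +
        derivAlong (hamiltonian P g) (bracket (compField J (compField J P)) h f) x +
        derivAlong (hamiltonian P f) (bracket (compField J (compField J P)) g h) x +
        derivAlong (hamiltonian (compField J (compField J P)) h) (bracket P f g) x -
        T f g h x + T g f h x = 0 := by
    intro f g h hf hg hh x
    have H := concomitant_differential_apply hP.1 hJ.1 hPJ hf hg (hQ.1.hamiltonian hh) x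
    change derivAlong (hamiltonian (compField J P) h) (bracket (compField J P) f g) x +
      (derivAlong (hamiltonian P g) (bracket (compField J (compField J P)) h f) x - T f g h x) -
      (derivAlong (hamiltonian P f) (bracket (compField J (compField J P)) h g) x - T g f h x) +
      derivAlong (hamiltonian (compField J (compField J P)) h) (bracket P f g) x = 0 at H
    rw [hR.derivAlong_bracket_swap _ h g] at H
    linarith
  have hB : ∀ {f g h : M → ℝ}, ContMDiff 𝓘(ℝ, E) 𝓘(ℝ, ℝ) ∞ f →
      ContMDiff 𝓘(ℝ, E) 𝓘(ℝ, ℝ) ∞ g → ContMDiff 𝓘(ℝ, E) 𝓘(ℝ, ℝ) ∞ h → ∀ x,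
      derivAlong (hamiltonian (compField J P) f) (bracket (compField J P) g h) x +
        derivAlong (hamiltonian P h) (bracket (compField J (compField J P)) f g) x +
        derivAlong (hamiltonian (compField J (compField J P)) f) (bracket P g h) x -
        T g h f x + T f g h x = 0 := by
    intro f g h hf hg hh x
    have H := concomitant_transpose_apply hP.1 hJ.1 hPJ hf hg (hP.1.1.hamiltonian hh) x
    rw [hP.mlieBracket_hamiltonian hg hh, VectorField.mlieBracket_swap_apply, map_neg,
      map_neg] at H
    have e1 : differential f x (J x (J x (hamiltonian P (bracket P g h) x))) = _ :=
      hR.nested_eq P g h f x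
    rw [e1] at H
    change -T g h f x + T f g h x - _ -
      derivAlong (hamiltonian (compField J P) f) (bracket (compField J P) h g) x +
      derivAlong (hamiltonian P h) (bracket (compField J (compField J P)) f g) x = 0 at H
    rw [hQ.derivAlong_bracket_swap _ h g] at H
    linarith
  refine hQ.isPoisson_iff.2 fun f g h hf hg hh x => ?_
  -- In cyclic sums, let `S` be the Jacobi sum of `J P`, `C` the sum of `P df {g, h}_{J²P}`, `D`
  -- that of `J²P df {g, h}_P`, and `t` that of `T f g h - T f h g`. Then `hT` gives `t = 2S - D`,
  -- `hA` gives `t = S + 2C + D`, and in `hB` the `T` terms cancel, leaving `S + C + D = 0`. Hence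
  -- `S = 2C + 2D = -2S`, so `S = 0`.
  linarith [hT hf hg hh x, hT hg hh hf x, hT hh hf hg x, hA hf hg hh x, hA hg hh hf x,
    hA hh hf hg x, hB hf hg hh x, hB hg hh hf x, hB hh hf hg x]

theorem IsBivectorField.sub_smul {P₁ P₂ : SharpField E M} (h₁ : IsBivectorField P₁)
    (h₂ : IsBivectorField P₂) (l : ℝ) : IsBivectorField (P₁ - l • P₂) := by
  refine ⟨h₁.1.sub_smul h₂.1 l, fun x a b => ?_⟩
  have e : ∀ a, (P₁ - l • P₂) x a = P₁ x a - l • P₂ x a := fun _ => rfl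
  have i₁ := h₁.2 x a b
  have i₂ := h₂.2 x a b
  simp only [e, map_sub, map_smul, smul_eq_mul]
  linear_combination i₁ - l * i₂

theorem bracket_sub_smul (P₁ P₂ : SharpField E M) (l : ℝ) (f g : M → ℝ) :
    bracket (P₁ - l • P₂) f g = bracket P₁ f g - l • bracket P₂ f g := by
  funext x
  change differential g x (P₁ x (differential f x) - l • P₂ x (differential f x)) = _
  rw [map_sub, map_smul]
  rfl

theorem derivAlong_bracket_sub_smul {P₁ P₂ : SharpField E M} (h₁ : SmoothSharpField P₁)
    (h₂ : SmoothSharpField P₂) (l : ℝ) (X : VectorField E M) {f g : M → ℝ}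
    (hf : ContMDiff 𝓘(ℝ, E) 𝓘(ℝ, ℝ) ∞ f) (hg : ContMDiff 𝓘(ℝ, E) 𝓘(ℝ, ℝ) ∞ g) (x : M) :
    derivAlong X (bracket (P₁ - l • P₂) f g) x =
      derivAlong X (bracket P₁ f g) x - l * derivAlong X (bracket P₂ f g) x := by
  rw [bracket_sub_smul, derivAlong_sub_smul X (h₁.bracket hf hg) (h₂.bracket hf hg)]
  rfl

theorem derivAlong_hamiltonian_sub_smul (P₁ P₂ : SharpField E M) (l : ℝ) (f g : M → ℝ) (x : M) :
    derivAlong (hamiltonian (P₁ - l • P₂) f) g x =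
      derivAlong (hamiltonian P₁ f) g x - l * derivAlong (hamiltonian P₂ f) g x :=
  congrFun (bracket_sub_smul P₁ P₂ l f g) x

theorem isPoisson_compField_sub_smul (hP : IsPoisson P) (hJ : IsNijenhuisTensor J)
    (hPJ : IsCompatible P J) (l : ℝ) : IsPoisson (compField J P - l • P) := by
  have hQ := isPoisson_compField hP hJ hPJ
  refine (hQ.1.sub_smul hP.1 l).isPoisson_iff.2 fun f g h hf hg hh x => ?_
  rw [derivAlong_hamiltonian_sub_smul, derivAlong_hamiltonian_sub_smul,
    derivAlong_hamiltonian_sub_smul]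
  simp only [derivAlong_bracket_sub_smul hQ.1.1 hP.1.1 l _ hf hg,
    derivAlong_bracket_sub_smul hQ.1.1 hP.1.1 l _ hg hh,
    derivAlong_bracket_sub_smul hQ.1.1 hP.1.1 l _ hh hf]
  -- The Jacobi sum is quadratic in the tensor: the coefficients of `1`, `-l`, `l ^ 2` are the
  -- Jacobi sum of `J P`, the mixed sum and the Jacobi sum of `P`.
  linear_combination hQ.1.isPoisson_iff.1 hQ f g h hf hg hh x -
    l * bracket_compField_cyclic hP hJ.1 hPJ hf hg hh x +
    l ^ 2 * hP.1.isPoisson_iff.1 hP f g h hf hg hh x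

theorem IsHomogeneous.sub_smul {P₁ P₂ : SharpField E M} {Z : VectorField E M}
    (h₁ : SmoothSharpField P₁) (h₂ : SmoothSharpField P₂) (H₁ : IsHomogeneous P₁ Z)
    (H₂ : IsHomogeneous P₂ Z) (l : ℝ) : IsHomogeneous (P₁ - l • P₂) Z := by
  intro f g hf hg
  funext x
  have i₁ : _ = -bracket P₁ f g x := congrFun (H₁ f g hf hg) x
  have i₂ : _ = -bracket P₂ f g x := congrFun (H₂ f g hf hg) x
  change derivAlong Z (bracket (P₁ - l • P₂) f g) x - bracket (P₁ - l • P₂) (derivAlong Z f) g x -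
    bracket (P₁ - l • P₂) f (derivAlong Z g) x = -bracket (P₁ - l • P₂) f g x
  rw [derivAlong_bracket_sub_smul h₁ h₂ l Z hf hg]
  simp only [bracket_sub_smul, Pi.sub_apply, Pi.smul_apply, smul_eq_mul]
  simp only [schoutenVectorBivector, Pi.sub_apply] at i₁ i₂
  linear_combination i₁ - l * i₂

end PoissonNijenhuis

end

end PoissonNijenhuis

end

theorem mainTheorem3
    {E : Type*} [NormedAddCommGroup E] [NormedSpace ℝ E] [FiniteDimensional ℝ E]
    {M : Type*} [TopologicalSpace M] [T2Space M] [ChartedSpace E M] [IsManifold 𝓘(ℝ, E) ∞ M]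
    (P : PoissonNijenhuis.SharpField E M) (Z : PoissonNijenhuis.VectorField E M)
    (J : PoissonNijenhuis.EndField E M)
    (hP : PoissonNijenhuis.IsHomogeneousPoisson P Z)
    (hJ : PoissonNijenhuis.IsNijenhuisTensor J)
    (hPJ : PoissonNijenhuis.IsCompatible P J) :
    (PoissonNijenhuis.IsHomogeneousPoisson (PoissonNijenhuis.compField J P) Z ↔
      ∀ α : PoissonNijenhuis.OneForm E M, PoissonNijenhuis.SmoothOneForm α →
        PoissonNijenhuis.sharp P
          (PoissonNijenhuis.lieDerivOneForm Z (PoissonNijenhuis.transposeForm J α) -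
            PoissonNijenhuis.transposeForm J (PoissonNijenhuis.lieDerivOneForm Z α)) = 0) ∧
    ((∀ α : PoissonNijenhuis.OneForm E M, PoissonNijenhuis.SmoothOneForm α →
        PoissonNijenhuis.sharp P
          (PoissonNijenhuis.lieDerivOneForm Z (PoissonNijenhuis.transposeForm J α) -
            PoissonNijenhuis.transposeForm J (PoissonNijenhuis.lieDerivOneForm Z α)) = 0) →
      PoissonNijenhuis.IsPoissonPencil (PoissonNijenhuis.compField J P) P ∧
      ∀ l : ℝ, PoissonNijenhuis.IsHomogeneous (PoissonNijenhuis.compField J P - l • P) Z) := by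
  have hQ := PoissonNijenhuis.isPoisson_compField hP.1 hJ hPJ
  have key := PoissonNijenhuis.isHomogeneous_compField_iff hP.1.1 hJ.1 hP.2.1 hP.2.2
  refine ⟨⟨fun H => key.1 H.2.2, fun H => ⟨hQ, hP.2.1, key.2 H⟩⟩, fun H => ⟨⟨hQ, hP.1,
    PoissonNijenhuis.isPoisson_compField_sub_smul hP.1 hJ hPJ⟩, fun l =>
    (key.2 H).sub_smul hQ.1.1 hP.1.1.1 hP.2.2 l⟩⟩
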